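/- Let $\mathscr{A}$ be a von Neumann algebra, that is, a $*$-subalgebra of the algebra $\mathbb{B}(\mathscr{H})$ of bounded operators on a complex Hilbert space $\mathscr{H}$ that contains the identity operator and is closed in the strong operator topology (equivalently, that equals its double commutant), and let $\mathscr{B}$ be a unital $C^*$-algebra. For a $C^*$-algebra $\mathscr{C}$, positivity of a $2\times 2$ matrix with entries in $\mathscr{C}$ means positivity in the $C^*$-algebra $M_2(\mathscr{C})$. A map $\Phi:\mathscr{A}\to\mathscr{B}$, not assumed linear, continuous or $*$-preserving, is called a Lieb map if (i) (monotonicity) $\Phi(A)\ge\Phi(B)$ for all $A,B\in\mathscr{A}$ with $A\ge B\ge 0$, and (ii) (Cauchy–Schwarz) $\begin{pmatrix}\Phi(A^*A)&\Phi(A^*B)\\ \Phi(A^*B)^*&\Phi(B^*B)\end{pmatrix}\ge 0$ for all $A,B\in\mathscr{A}$. Then an arbitrary map $\Phi:\mathscr{A}\to\mathscr{B}$ is a Lieb map if and only if $$\begin{pmatrix}\Phi(A)&\Phi(C)\\ \Phi(C)^*&\Phi(B)\end{pmatrix}\ge 0$$ for all $A,B,C\in\mathscr{A}$ such that $\begin{pmatrix}A&C\\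 C^*&B\end{pmatrix}\ge 0$. -/

import Mathlib

/-! ## Concrete von Neumann algebras as C⋆-algebras -/

namespace VonNeumannAlgebra

variable {H : Type*} [NormedAddCommGroup H] [InnerProductSpace ℂ H] [CompleteSpace H]

instance instSMulMemClass : SMulMemClass (VonNeumannAlgebra H) ℂ (H →L[ℂ] H) where
  smul_mem {s} c _ hx := s.toStarSubalgebra.toSubalgebra.smul_mem hx c

/-- A von Neumann algebra is norm closed, because it is a commutant. -/
theorem isClosed_coe (S : VonNeumannAlgebra H) : IsClosed (S : Set (H →L[ℂ] H)) := by
  rw [← S.centralizer_centralizer]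
  exact Set.isClosed_centralizer _

/-- A von Neumann algebra, with the operations and the norm of the ambient `H →L[ℂ] H`, is a
C⋆-algebra. -/
noncomputable instance instCStarAlgebra (S : VonNeumannAlgebra H) : CStarAlgebra S :=
  StarSubalgebra.cstarAlgebra S (h_closed := S.isClosed_coe)

/-- The Löwner order that a von Neumann algebra inherits from the ambient `H →L[ℂ] H` is its order
as a C⋆-algebra: the positive elements are exactly the sums of elements `star a * a` with `a` in
the algebra. -/
instance instStarOrderedRing (S : VonNeumannAlgebra H) : StarOrderedRing S := by
  refine StarOrderedRing.of_nonneg_iff' (fun {x y} hxy z => ?_) (fun x => ⟨fun hx => ?_, ?_⟩)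
  · exact add_le_add_right (α := H →L[ℂ] H) hxy z
  · have hx' : (0 : H →L[ℂ] H) ≤ (x : H →L[ℂ] H) := hx
    have hs : CFC.sqrt (x : H →L[ℂ] H) ∈ S := by
      rw [CFC.sqrt_eq_real_sqrt _ hx']
      exact cfcₙ_mem (𝕜' := ℂ) (hs := S.isClosed_coe) Real.sqrt x.2
    refine ⟨⟨CFC.sqrt (x : H →L[ℂ] H), hs⟩, Subtype.ext ?_⟩
    have h1 : star (CFC.sqrt (x : H →L[ℂ] H)) = CFC.sqrt (x : H →L[ℂ] H) :=
      (CFC.sqrt_nonneg (x : H →L[ℂ] H)).isSelfAdjoint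
    change (x : H →L[ℂ] H) = star (CFC.sqrt (x : H →L[ℂ] H)) * CFC.sqrt (x : H →L[ℂ] H)
    rw [h1, CFC.sqrt_mul_sqrt_self _ hx']
  · rintro ⟨s, rfl⟩
    exact star_mul_self_nonneg (s : H →L[ℂ] H)

end VonNeumannAlgebra

/-! ## Lieb maps -/

/-- The block matrix with rows `(a, b)` and `(c, d)`, as an element of the C⋆-algebra of
two by two matrices over `A`. -/
def blockMatrix {A : Type*} (a b c d : A) : CStarMatrix (Fin 2) (Fin 2) A :=
  CStarMatrix.ofMatrix !![a, b; c, d]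

/-- A (not necessarily linear) map between C⋆-algebras is a Lieb map if it is monotone on the
positive elements and satisfies the matrix form of the Cauchy–Schwarz inequality. The positivity
of block matrices is the one of the C⋆-algebra of two by two matrices. -/
structure IsLiebMap {A B : Type*}
    [NonUnitalCStarAlgebra A] [PartialOrder A] [StarOrderedRing A]
    [NonUnitalCStarAlgebra B] [PartialOrder B] [StarOrderedRing B] (Φ : A → B) : Prop where
  /-- Monotonicity on positive elements. -/
  monotone : ∀ a b : A, 0 ≤ b → b ≤ a → Φ b ≤ Φ a
  /-- The matrix Cauchy–Schwarz condition. -/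
  cauchySchwarz : ∀ a b : A,
    0 ≤ blockMatrix (Φ (star a * a)) (Φ (star a * b)) (star (Φ (star a * b))) (Φ (star b * b))

open scoped InnerProductSpace

section BlockMatrix

/-! The matrix condition gives monotonicity when tested on `(b, b; b, b)` with its first corner
raised to `a`, and Cauchy–Schwarz when tested on Gram matrices of two elements. Conversely, a
positive matrix with diagonal `a`, `b` and corner `c` is a Gram matrix of `u`, `d` with its last
corner raised from `star d * d` to `b`: Cauchy–Schwarz handles the Gram matrix and monotonicity the
enlargement. Finding `u`, `d` inside the algebra is the main point
(`exists_factorization_of_blockMatrix_nonneg`): `d` is the adjoint of a Douglas factor, which the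
double commutant theorem keeps in the algebra. -/

theorem blockMatrix_add {A : Type*} [Add A] (a b c d a' b' c' d' : A) :
    blockMatrix a b c d + blockMatrix a' b' c' d' =
      blockMatrix (a + a') (b + b') (c + c') (d + d') := by
  ext i j
  fin_cases i <;> fin_cases j <;> rfl

theorem star_blockMatrix_mul_self {A : Type*} [NonUnitalSemiring A] [StarRing A] (p q r s : A) :
    star (blockMatrix p r q s) * blockMatrix p r q s =
      blockMatrix (star p * p + star q * q) (star p * r + star q * s)
        (star r * p + star s * q) (star r * r + star s * s) := by
  ext i j
  fin_cases i <;> fin_cases j <;>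
    simp [blockMatrix, CStarMatrix.mul_apply, CStarMatrix.star_apply, Fin.sum_univ_two]

variable {A : Type*} [NonUnitalCStarAlgebra A] [PartialOrder A] [StarOrderedRing A]

theorem exists_eq_star_mul_self_of_nonneg {a : A} (ha : 0 ≤ a) : ∃ b : A, a = star b * b :=
  CStarAlgebra.nonneg_iff_eq_star_mul_self.mp ha

/-- A two by two block matrix is positive if and only if it is a Gram matrix of two columns. -/
theorem blockMatrix_nonneg_iff {a b c d : A} :
    0 ≤ blockMatrix a b c d ↔ ∃ p q r s : A,
      a = star p * p + star q * q ∧ b = star p * r + star q * s ∧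
        c = star r * p + star s * q ∧ d = star r * r + star s * s := by
  constructor
  · intro h
    obtain ⟨N, hN⟩ := exists_eq_star_mul_self_of_nonneg h
    have hN' : N = blockMatrix (N 0 0) (N 0 1) (N 1 0) (N 1 1) := by
      ext i j
      fin_cases i <;> fin_cases j <;> rfl
    rw [hN', star_blockMatrix_mul_self] at hN
    exact ⟨_, _, _, _, congr_fun (congr_fun hN 0) 0, congr_fun (congr_fun hN 0) 1,
      congr_fun (congr_fun hN 1) 0, congr_fun (congr_fun hN 1) 1⟩
  · rintro ⟨p, q, r, s, rfl, rfl, rfl, rfl⟩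
    rw [← star_blockMatrix_mul_self]
    exact star_mul_self_nonneg _

/-- Enlarging the lower right corner keeps a block matrix positive. -/
theorem blockMatrix_nonneg_of_le {a b c d d' : A} (h : 0 ≤ blockMatrix a b c d) (hd : d ≤ d') :
    0 ≤ blockMatrix a b c d' := by
  obtain ⟨r, hr⟩ := exists_eq_star_mul_self_of_nonneg (sub_nonneg.mpr hd)
  have h' : 0 ≤ blockMatrix 0 0 0 (d' - d) :=
    blockMatrix_nonneg_iff.mpr ⟨0, 0, 0, r, by simp, by simp, by simp, by simp [hr]⟩
  simpa [blockMatrix_add] using add_nonneg h h'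

/-- Compression by the vector `(1, -1)` gives `a - b`, written out on Gram columns; `b` is
self-adjoint as a diagonal entry. -/
theorem le_of_blockMatrix_nonneg {a b : A} (h : 0 ≤ blockMatrix a b (star b) b) : b ≤ a := by
  obtain ⟨p, q, r, s, ha, hb, hb', hd⟩ := blockMatrix_nonneg_iff.mp h
  have hsa : star b = b := by
    rw [hd]
    simp
  rw [hsa] at hb'
  have key : a - b = star (p - r) * (p - r) + star (q - s) * (q - s) := by
    calc a - b = a - b - b + b := by abel
      _ = (star p * p + star q * q) - (star p * r + star q * s) - (star r * p + star s * q)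
          + (star r * r + star s * s) := by rw [← ha, ← hb, ← hb', ← hd]
      _ = _ := by
        simp only [star_sub, sub_mul, mul_sub]
        abel
  rw [← sub_nonneg, key]
  exact add_nonneg (star_mul_self_nonneg _) (star_mul_self_nonneg _)

/-- The matrix is the all-`b` matrix plus the diagonal matrix with entries `a - b` and `0`. -/
theorem blockMatrix_self_nonneg_of_le {a b : A} (hb : 0 ≤ b) (hab : b ≤ a) :
    0 ≤ blockMatrix a b (star b) b := by
  obtain ⟨p, rfl⟩ := exists_eq_star_mul_self_of_nonneg hb
  obtain ⟨q, hq⟩ := exists_eq_star_mul_self_of_nonneg (sub_nonneg.mpr hab)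
  exact blockMatrix_nonneg_iff.mpr
    ⟨p, q, p, 0, by rw [← hq]; abel, by simp, by simp, by simp⟩

theorem blockMatrix_star_mul_nonneg (a b : A) :
    0 ≤ blockMatrix (star a * a) (star a * b) (star (star a * b)) (star b * b) :=
  blockMatrix_nonneg_iff.mpr ⟨a, 0, b, 0, by simp, by simp, by simp, by simp⟩

end BlockMatrix

namespace VonNeumannAlgebra

variable {H : Type*} [NormedAddCommGroup H] [InnerProductSpace ℂ H] [CompleteSpace H]

/-- Douglas factorization: if `t` is dominated by `s`, then `t = v * s`, where `v` is in the von
Neumann algebra that contains `s` and `t` and is supported on the closure of the range of `s`. -/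
theorem exists_mul_eq_of_norm_le (M : VonNeumannAlgebra H) {s t : H →L[ℂ] H} (hs : s ∈ M)
    (ht : t ∈ M) {C : ℝ} (h : ∀ x, ‖t x‖ ≤ C * ‖s x‖) :
    ∃ v ∈ M, v * s = t ∧ ∀ z, ∃ k ∈ closure (Set.range s), v z = v k ∧ ‖k‖ ≤ ‖z‖ := by
  set K : Submodule ℂ H := s.range.topologicalClosure with hK
  have hmem : ∀ x, s x ∈ K := fun x =>
    Submodule.le_topologicalClosure _ (LinearMap.mem_range_self _ x)
  let e : H →ₗ[ℂ] K := s.toLinearMap.codRestrict K hmem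
  have he : DenseRange e := by
    intro y
    rw [closure_subtype]
    have : ((↑) '' Set.range e : Set H) = Set.range s := by
      rw [← Set.range_comp]
      rfl
    rw [this]
    exact y.2
  have hbound : ∀ x, ‖t.toLinearMap x‖ ≤ C * ‖e x‖ := h
  let w : K →L[ℂ] H := t.toLinearMap.extendOfNorm e
  have hw : ∀ x, w (e x) = t x := LinearMap.extendOfNorm_eq he ⟨C, hbound⟩
  let v : H →L[ℂ] H := w ∘L K.orthogonalProjectionOnto
  have hvs : ∀ x, v (s x) = t x := fun x => by
    have : K.orthogonalProjectionOnto (s x) = e x :=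
      K.orthogonalProjectionOnto_mem_subspace_eq_self (e x)
    simp only [v, ContinuousLinearMap.comp_apply, this, hw]
  have hv0 : ∀ y ∈ Kᗮ, v y = 0 := fun y hy => by
    simp only [v, ContinuousLinearMap.comp_apply,
      K.orthogonalProjectionOnto_apply_of_mem_orthogonal hy, map_zero]
  have hvP : ∀ z, v z = v (K.starProjection z) := fun z => by
    rw [← sub_eq_zero, ← map_sub]
    exact hv0 _ (K.sub_starProjection_mem_orthogonal z)
  have hmemK : ∀ z, z ∈ Kᗮ ↔ ∀ x, ⟪s x, z⟫_ℂ = 0 := fun z => by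
    rw [hK, Submodule.orthogonal_closure, Submodule.mem_orthogonal]
    exact ⟨fun hz x => hz _ (LinearMap.mem_range_self _ x), by rintro hz _ ⟨x, rfl⟩; exact hz x⟩
  refine ⟨v, ?_, ContinuousLinearMap.ext hvs, fun z => ⟨K.starProjection z,
    K.starProjection_apply_mem z, hvP z, K.norm_starProjection_apply_le z⟩⟩
  -- It suffices that `v` commutes with each `g` in the commutant, checked on `K` and on `Kᗮ`
  -- separately.
  rw [← M.commutant_commutant, mem_commutant_iff]
  intro g hg
  have comm : ∀ g ∈ M.commutant, ∀ u ∈ M, ∀ x, u (g x) = g (u x) := fun g hg u hu x =>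
    DFunLike.congr_fun (mem_commutant_iff.mp hg u hu) x
  -- `star g` also commutes with `s`, so it preserves the range of `s`.
  have hgK : ∀ z ∈ Kᗮ, g z ∈ Kᗮ := fun z hz => by
    rw [hmemK] at hz ⊢
    intro x
    rw [← ContinuousLinearMap.adjoint_inner_left, ← ContinuousLinearMap.star_eq_adjoint,
      ← comm _ (star_mem hg) s hs]
    exact hz _
  have hcl : ∀ k ∈ K, g (v k) = v (g k) := by
    have hclosed : IsClosed {k | g (v k) = v (g k)} := isClosed_eq (by fun_prop) (by fun_prop)
    refine fun k hk => closure_minimal ?_ hclosed hk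
    rintro _ ⟨x, rfl⟩
    change g (v (s x)) = v (g (s x))
    rw [hvs, ← comm g hg s hs, hvs, comm g hg t ht]
  ext z
  change g (v z) = v (g z)
  rw [hvP, hcl _ (K.starProjection_apply_mem z), eq_comm, ← sub_eq_zero, ← map_sub, ← map_sub]
  exact hv0 _ (hgK _ (K.sub_starProjection_mem_orthogonal z))

theorem coe_star_mul_self_inner (M : VonNeumannAlgebra H) (u v : M) (x y : H) :
    ⟪x, ((star u * v : M) : H →L[ℂ] H) y⟫_ℂ = ⟪(u : H →L[ℂ] H) x, (v : H →L[ℂ] H) y⟫_ℂ :=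
  ContinuousLinearMap.adjoint_inner_right (u : H →L[ℂ] H) x ((v : H →L[ℂ] H) y)

theorem norm_sq_eq_of_star_mul_self_eq (M : VonNeumannAlgebra H) {u p q : M}
    (h : star u * u = star p * p + star q * q) (x : H) :
    ‖(u : H →L[ℂ] H) x‖ ^ 2 = ‖(p : H →L[ℂ] H) x‖ ^ 2 + ‖(q : H →L[ℂ] H) x‖ ^ 2 := by
  have h1 : ⟪x, ((star u * u : M) : H →L[ℂ] H) x⟫_ℂ =
      ⟪x, ((star p * p : M) : H →L[ℂ] H) x⟫_ℂ + ⟪x, ((star q * q : M) : H →L[ℂ] H) x⟫_ℂ := by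
    rw [h, ← inner_add_right]
    rfl
  simp only [coe_star_mul_self_inner, inner_self_eq_norm_sq_to_K] at h1
  exact_mod_cast h1

theorem star_mul_self_le_of_norm_sq_le (M : VonNeumannAlgebra H) {d r s : M}
    (h : ∀ y, ‖(d : H →L[ℂ] H) y‖ ^ 2 ≤ ‖(r : H →L[ℂ] H) y‖ ^ 2 + ‖(s : H →L[ℂ] H) y‖ ^ 2) :
    star d * d ≤ star r * r + star s * s := by
  change ((star d * d : M) : H →L[ℂ] H) ≤ ((star r * r : M) : H →L[ℂ] H) + (star s * s : M)
  rw [ContinuousLinearMap.le_def, ContinuousLinearMap.isPositive_def']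
  refine ⟨?_, fun y => ?_⟩
  · exact ((IsSelfAdjoint.star_mul_self _).add (.star_mul_self _)).sub (.star_mul_self _)
  · rw [ContinuousLinearMap.reApplyInnerSelf_apply, inner_re_symm]
    simp only [sub_apply, add_apply, inner_sub_right,
      inner_add_right, coe_star_mul_self_inner, inner_self_eq_norm_sq_to_K, map_sub, map_add]
    have := h y
    norm_cast
    linarith

/-- In a von Neumann algebra, the off-diagonal entry `c` of a positive block matrix with diagonal
`a`, `b` factors as `c = star u * d` with `star u * u = a` and `star d * d ≤ b`. -/
theorem exists_factorization_of_blockMatrix_nonneg (M : VonNeumannAlgebra H) {a b c c' : M}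
    (h : 0 ≤ blockMatrix a c c' b) :
    ∃ u d : M, star u * u = a ∧ star u * d = c ∧ star d * d ≤ b := by
  obtain ⟨p, q, r, s, ha, hc, -, hb⟩ := blockMatrix_nonneg_iff.mp h
  have ha0 : 0 ≤ a := ha ▸ add_nonneg (star_mul_self_nonneg _) (star_mul_self_nonneg _)
  obtain ⟨u, hu⟩ := exists_eq_star_mul_self_of_nonneg ha0
  have hnorm := M.norm_sq_eq_of_star_mul_self_eq (hu.symm.trans ha)
  have hcs : star c = star r * p + star s * q := by simp [hc]
  have hcs' : ∀ x, ((star c : M) : H →L[ℂ] H) x =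
      ((star r : M) : H →L[ℂ] H) ((p : H →L[ℂ] H) x) +
        ((star s : M) : H →L[ℂ] H) ((q : H →L[ℂ] H) x) := fun x => by
    rw [hcs]
    rfl
  -- Since `‖u x‖² = ‖p x‖² + ‖q x‖²`, `u` dominates `star c`, so `star c = v * u`, and `d = star
  -- v`.
  have hdom : ∀ x, ‖((star c : M) : H →L[ℂ] H) x‖ ≤
      (‖((star r : M) : H →L[ℂ] H)‖ + ‖((star s : M) : H →L[ℂ] H)‖) * ‖(u : H →L[ℂ] H) x‖ := by
    intro x
    have hp : ‖(p : H →L[ℂ] H) x‖ ≤ ‖(u : H →L[ℂ] H) x‖ :=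
      le_of_sq_le_sq (by rw [hnorm]; exact le_add_of_nonneg_right (sq_nonneg _)) (norm_nonneg _)
    have hq : ‖(q : H →L[ℂ] H) x‖ ≤ ‖(u : H →L[ℂ] H) x‖ :=
      le_of_sq_le_sq (by rw [hnorm]; exact le_add_of_nonneg_left (sq_nonneg _)) (norm_nonneg _)
    rw [hcs', add_mul]
    refine (norm_add_le _ _).trans (add_le_add ?_ ?_)
    · exact (ContinuousLinearMap.le_opNorm _ _).trans (by gcongr)
    · exact (ContinuousLinearMap.le_opNorm _ _).trans (by gcongr)
  obtain ⟨v, hvM, hvu, hvK⟩ := M.exists_mul_eq_of_norm_le u.2 (star c).2 hdom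
  set d : M := star ⟨v, hvM⟩ with hd
  have hdadj : ∀ z y, ⟪z, (d : H →L[ℂ] H) y⟫_ℂ = ⟪v z, y⟫_ℂ :=
    ContinuousLinearMap.adjoint_inner_right v
  refine ⟨u, d, hu.symm, ?_, ?_⟩
  · have hvu' : (⟨v, hvM⟩ : M) * u = star c := Subtype.ext hvu
    rw [hd, ← star_mul, hvu', star_star]
  rw [hb]
  refine M.star_mul_self_le_of_norm_sq_le fun y => ?_
  set β : ℝ := √(‖(r : H →L[ℂ] H) y‖ ^ 2 + ‖(s : H →L[ℂ] H) y‖ ^ 2) with hβ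
  have hβsq : β ^ 2 = ‖(r : H →L[ℂ] H) y‖ ^ 2 + ‖(s : H →L[ℂ] H) y‖ ^ 2 :=
    Real.sq_sqrt (by positivity)
  have hβ0 : 0 ≤ β := Real.sqrt_nonneg _
  have hrange : ∀ k ∈ closure (Set.range (u : H →L[ℂ] H)), ‖⟪v k, y⟫_ℂ‖ ≤ β * ‖k‖ := by
    have hclosed : IsClosed {k | ‖⟪v k, y⟫_ℂ‖ ≤ β * ‖k‖} :=
      isClosed_le (by fun_prop) (by fun_prop)
    refine fun k hk => closure_minimal ?_ hclosed hk
    rintro _ ⟨x, rfl⟩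
    have hvx : v ((u : H →L[ℂ] H) x) = ((star c : M) : H →L[ℂ] H) x := DFunLike.congr_fun hvu x
    have hinner : ⟪v ((u : H →L[ℂ] H) x), y⟫_ℂ =
        ⟪(p : H →L[ℂ] H) x, (r : H →L[ℂ] H) y⟫_ℂ + ⟪(q : H →L[ℂ] H) x, (s : H →L[ℂ] H) y⟫_ℂ := by
      rw [hvx, hcs', inner_add_left]
      exact congrArg₂ _ (ContinuousLinearMap.adjoint_inner_left _ _ _)
        (ContinuousLinearMap.adjoint_inner_left _ _ _)
    change ‖⟪v ((u : H →L[ℂ] H) x), y⟫_ℂ‖ ≤ β * ‖(u : H →L[ℂ] H) x‖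
    rw [hinner]
    refine (norm_add_le _ _).trans ((add_le_add (norm_inner_le_norm _ _)
      (norm_inner_le_norm _ _)).trans (le_of_sq_le_sq ?_ (by positivity)))
    rw [mul_pow, hβsq, hnorm]
    -- Lagrange's identity: Cauchy–Schwarz in the plane.
    nlinarith [sq_nonneg (‖(p : H →L[ℂ] H) x‖ * ‖(s : H →L[ℂ] H) y‖ -
      ‖(q : H →L[ℂ] H) x‖ * ‖(r : H →L[ℂ] H) y‖)]
  -- The bound `hrange` holds only on the closure of the range of `u`; the support property of `v`
  -- moves `d y` there without increasing its norm.
  have hself : ‖(d : H →L[ℂ] H) y‖ ^ 2 ≤ β * ‖(d : H →L[ℂ] H) y‖ := by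
    obtain ⟨k, hk, hvk, hkz⟩ := hvK ((d : H →L[ℂ] H) y)
    calc ‖(d : H →L[ℂ] H) y‖ ^ 2 = ‖⟪(d : H →L[ℂ] H) y, (d : H →L[ℂ] H) y⟫_ℂ‖ := by
          simp [inner_self_eq_norm_sq_to_K]
      _ = ‖⟪v k, y⟫_ℂ‖ := by rw [hdadj, hvk]
      _ ≤ β * ‖k‖ := hrange k hk
      _ ≤ _ := by gcongr
  rw [← hβsq]
  have : ‖(d : H →L[ℂ] H) y‖ ≤ β := by
    by_contra! hlt
    nlinarith
  gcongr

end VonNeumannAlgebra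

theorem proposition2p3 {H : Type*} [NormedAddCommGroup H] [InnerProductSpace ℂ H] [CompleteSpace H]
    (𝒜 : VonNeumannAlgebra H)
    {ℬ : Type*} [CStarAlgebra ℬ] [PartialOrder ℬ] [StarOrderedRing ℬ] (Φ : 𝒜 → ℬ) :
    IsLiebMap Φ ↔
      ∀ a b c : 𝒜, 0 ≤ blockMatrix a c (star c) b →
        0 ≤ blockMatrix (Φ a) (Φ c) (star (Φ c)) (Φ b) := by
  constructor
  · intro hΦ a b c h
    obtain ⟨u, d, rfl, rfl, hd⟩ := 𝒜.exists_factorization_of_blockMatrix_nonneg h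
    exact blockMatrix_nonneg_of_le (hΦ.cauchySchwarz u d)
      (hΦ.monotone _ _ (star_mul_self_nonneg d) hd)
  · intro h
    exact ⟨fun a b hb hab =>
        le_of_blockMatrix_nonneg (h a b b (blockMatrix_self_nonneg_of_le hb hab)),
      fun a b => h _ _ _ (blockMatrix_star_mul_nonneg a b)⟩
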